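/- Let $m\ge 2$ be an integer with $m\equiv 2\pmod 4$, and let $F$ be a field with $\operatorname{char}F=0$ or $2m<\operatorname{char}F$. Let $V_m$ be the space of homogeneous polynomials of degree $m$ in $F[X,Y]$, on which $A=(a_{ij})\in \mathrm{SL}(2,F)$ acts (on the right) by the substitution $X\mapsto a_{11}X+a_{12}Y$, $Y\mapsto a_{21}X+a_{22}Y$. Then $V_m$ is an $(m+1)$-dimensional absolutely irreducible $\mathrm{SL}(2,F)$-module (that is, $K\otimes_F V_m$ is irreducible for every field extension $K/F$), and it is ESQ: there is a submodule $U\le \wedge^2V_m$ with $\wedge^2V_m/U\cong V_m$. Moreover, let $\psi:\wedge^2V_m\to V_m$ be any epimorphism of $\mathrm{SL}(2,F)$-modules (such $\psi$ exist because $V_m$ is ESQ), and let $L$ be the corresponding algebra, i.e. the vector space $V_m$ with the product $[u,v]=\psi(u\wedge v)$. Then $L$ is an IAC algebra: $[x,x]=0$ for all $x\in L$, and $\mathrm{Aut}(L)$ acts irreducibly on $L$. The group $\mathrm{SL}(2,F)$ acts on $L$ by algebra automorphisms, and the kernel of this action is $\{\pm I\}$, so $\mathrm{PSL}(2,F)=\mathrm{SL}(2,F)/\{\pm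 I\}$ embeds in $\mathrm{Aut}(L)$. If $|F|\ge 5$, then $L$ is simple, i.e. $L\neq 0$ and its only two-sided ideals are $0$ and $L$. -/

import Mathlib

open MvPolynomial
open scoped MatrixGroups

universe u v₁ v₂ w

section Representations

variable {k : Type u} {G : Type v₁} {V : Type v₂} [Group G] [Field k] [AddCommGroup V] [Module k V]

/-- The extension of scalars of a representation `V` of `G` over `k` to a field `K` over `k`:
`g` acts on `K ⊗ V` by `1 ⊗ g`. -/
noncomputable def repBaseChange (K : Type w) [Field K] [Algebra k K] (ρ : Representation k G V) :
    Representation K G (TensorProduct k K V) where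
  toFun g := (ρ g).baseChange K
  map_one' := by
    rw [map_one]
    exact LinearMap.baseChange_one k V
  map_mul' g h := by
    rw [map_mul]
    exact LinearMap.baseChange_mul (ρ g) (ρ h)

/-- A representation over `k` is absolutely irreducible if it is irreducible after extension of
scalars to every field `K` over `k`. -/
def IsAbsolutelyIrreducible (ρ : Representation k G V) : Prop :=
  ∀ (K : Type w) [Field K] [Algebra k K], (repBaseChange K ρ).IsIrreducible

/-- The exterior square of a representation: `g` acts on `⋀² V` by
`x ∧ y ↦ (g x) ∧ (g y)`. -/
noncomputable def extSquare (ρ : Representation k G V) : Representation k G (⋀[k]^2 V) where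
  toFun g := exteriorPower.map 2 (ρ g)
  map_one' := by
    rw [map_one]
    exact exteriorPower.map_id
  map_mul' g h := by
    rw [map_mul]
    exact (exteriorPower.map_comp (n := 2) (ρ h) (ρ g))

/-- A representation `V` is ESQ (exterior self-quotient) if there is a subrepresentation `U` of
`⋀² V` such that the quotient representation `⋀² V / U` is isomorphic to `V`. -/
def IsESQ (ρ : Representation k G V) : Prop :=
  ∃ (U : Submodule k (⋀[k]^2 V)) (hU : ∀ g, U ≤ U.comap (extSquare ρ g)),
    Nonempty (((extSquare ρ).quotient U hU).Equiv ρ)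

/-- The bilinear product `(x, y) ↦ ψ (x ∧ y)` on `V` given by a linear map `ψ : ⋀² V → V`. -/
noncomputable def wedgeProduct (ψ : ⋀[k]^2 V →ₗ[k] V) : V →ₗ[k] V →ₗ[k] V :=
  LinearMap.mk₂ k (fun x y => ψ (exteriorPower.ιMulti k 2 ![x, y]))
    (fun x x' y => by
      have e : ∀ z : V, Function.update ![x, y] 0 z = ![z, y] := by
        intro z; ext i; fin_cases i <;> simp
      have h := (exteriorPower.ιMulti k 2 (M := V)).map_update_add ![x, y] 0 x x'
      rw [e, e, e] at h
      rw [h, map_add])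
    (fun c x y => by
      have e : ∀ z : V, Function.update ![x, y] 0 z = ![z, y] := by
        intro z; ext i; fin_cases i <;> simp
      have h := (exteriorPower.ιMulti k 2 (M := V)).map_update_smul ![x, y] 0 c x
      rw [e, e] at h
      rw [h, map_smul])
    (fun x y y' => by
      have e : ∀ z : V, Function.update ![x, y] 1 z = ![x, z] := by
        intro z; ext i; fin_cases i <;> simp
      have h := (exteriorPower.ιMulti k 2 (M := V)).map_update_add ![x, y] 1 y y'
      rw [e, e, e] at h
      rw [h, map_add])
    (fun c x y => by
      have e : ∀ z : V, Function.update ![x, y] 1 z = ![x, z] := by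
        intro z; ext i; fin_cases i <;> simp
      have h := (exteriorPower.ιMulti k 2 (M := V)).map_update_smul ![x, y] 1 c y
      rw [e, e] at h
      rw [h, map_smul])

end Representations

/-! A (not necessarily associative) algebra over `k` is a vector space `L` with a bilinear
product `B : L →ₗ[k] L →ₗ[k] L`. -/
section Algebras

variable {k : Type u} {L : Type*} [Field k] [AddCommGroup L] [Module k L]

/-- The automorphism group of the algebra `(L, B)`, as a group of linear automorphisms of `L`. -/
def algAut (B : L →ₗ[k] L →ₗ[k] L) : Subgroup (L ≃ₗ[k] L) where
  carrier := {a | ∀ x y, a (B x y) = B (a x) (a y)}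
  one_mem' := fun _ _ => rfl
  mul_mem' := by
    intro a b ha hb x y
    rw [LinearEquiv.mul_apply, hb, ha]
    rfl
  inv_mem' := by
    intro a ha x y
    apply a.injective
    have h : ∀ z, a (a⁻¹ z) = z := fun z => a.apply_symm_apply z
    rw [ha, h, h, h]

/-- The natural representation of the automorphism group of `(L, B)` on `L`. -/
def algAutRep (B : L →ₗ[k] L →ₗ[k] L) : Representation k (algAut B) L where
  toFun a := (a : L ≃ₗ[k] L).toLinearMap
  map_one' := rfl
  map_mul' _ _ := rfl

/-- `(L, B)` is an IAC algebra if it is anti-commutative (`x x = 0` for all `x`) and its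
automorphism group acts irreducibly on `L`. -/
def IsIAC (B : L →ₗ[k] L →ₗ[k] L) : Prop :=
  B.IsAlt ∧ (algAutRep B).IsIrreducible

/-- `I` is a two-sided ideal of the algebra `(L, B)`. -/
def IsAlgIdeal (B : L →ₗ[k] L →ₗ[k] L) (I : Submodule k L) : Prop :=
  ∀ x ∈ I, ∀ y : L, B x y ∈ I ∧ B y x ∈ I

/-- The algebra `(L, B)` is simple: it is nonzero and its only ideals are `0` and `L`. -/
def IsSimpleAlg (B : L →ₗ[k] L →ₗ[k] L) : Prop :=
  Nontrivial L ∧ ∀ I : Submodule k L, IsAlgIdeal B I → I = ⊥ ∨ I = ⊤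

end Algebras

section BinaryForms

variable (F : Type u) [Field F]

/-- The substitution `X ↦ a₁₁ X + a₁₂ Y`, `Y ↦ a₂₁ X + a₂₂ Y` on `F[X, Y]`, where `X = X 0` and
`Y = X 1`. This is a right action: substituting by `A` and then by `B` is substituting
by `A * B`. -/
noncomputable def formSubst (A : Matrix (Fin 2) (Fin 2) F) :
    MvPolynomial (Fin 2) F →ₐ[F] MvPolynomial (Fin 2) F :=
  aeval fun i => C (A i 0) * X 0 + C (A i 1) * X 1

theorem formSubst_one : formSubst F 1 = AlgHom.id F _ := by
  ext i : 1
  fin_cases i <;> simp [formSubst]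

theorem formSubst_mul (A B : Matrix (Fin 2) (Fin 2) F) :
    formSubst F (A * B) = (formSubst F B).comp (formSubst F A) := by
  ext i : 1
  simp only [formSubst, AlgHom.comp_apply, aeval_X, map_add, map_mul, Matrix.mul_apply,
    Fin.sum_univ_two, algHom_C, algebraMap_eq]
  ring

theorem formSubst_mem (A : Matrix (Fin 2) (Fin 2) F) (m : ℕ) (f : MvPolynomial (Fin 2) F)
    (hf : f ∈ homogeneousSubmodule (Fin 2) F m) :
    (formSubst F A).toLinearMap f ∈ homogeneousSubmodule (Fin 2) F m := by
  have h := IsHomogeneous.aeval (S := F) (n := 1) hf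
    (fun i : Fin 2 => C (A i 0) * (X 0 : MvPolynomial (Fin 2) F) + C (A i 1) * X 1)
    (fun i => (isHomogeneous_C_mul_X _ _).add (isHomogeneous_C_mul_X _ _))
  rw [one_mul] at h
  exact h

/-- The `SL(2, F)`-module `V_m` of homogeneous polynomials of degree `m` in `F[X, Y]`. The right
action by substitution is turned into a left action in the usual way, `g` acting as `g⁻¹` acts
on the right. -/
noncomputable def binaryForms (m : ℕ) :
    Representation F SL(2, F) (homogeneousSubmodule (Fin 2) F m) where
  toFun g := (formSubst F (g⁻¹ : SL(2, F)).1).toLinearMap.restrict (formSubst_mem F _ m)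
  map_one' := by
    ext f : 2
    simp [formSubst_one]
  map_mul' g h := by
    ext f : 2
    simp only [mul_inv_rev, Matrix.SpecialLinearGroup.coe_mul, formSubst_mul]
    rfl

end BinaryForms

open scoped TensorProduct

/-! Lie algebra methods work here although only the group acts. The lower unipotent elements act as
polynomials in `t` whose linear coefficient is `X ∂/∂Y`. In the given characteristic the points `t =
0, 1, …, 2m` are distinct, so coefficients of `t` can be compared: invariant subspaces are stable
under `X ∂/∂Y` (`LoweringData.D_one_mem`), and this operator is a derivation of every equivariant
product (`LoweringData.D_one_leibniz`).

Irreducibility: lowering a nonzero vector reaches `X ^ m`, the Weyl element turns this into `Y ^ m`,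
and lowering again gives all monomials. The same data exist over every extension field, hence
absolute irreducibility.

ESQ: with `m = 2r` and `r` odd, the `r`-th transvectant is a nonzero equivariant alternating product
on `V_m`; by irreducibility it induces an epimorphism from the exterior square.

Simplicity (`LoweringData.isSimpleAlg`): let `J` be a minimal nonzero ideal. If `J J ≠ 0`, then `J`
is stable under all conjugates of the derivation, and the irreducibility argument needs no more than
that. If `J J = 0`, all translates of `J` annihilate one another; they span the algebra, so the
product would vanish. -/

/-- A Vandermonde argument modulo `W`: every functional on the quotient yields a polynomial of
degree at most `n` with the `n + 1` distinct roots `0, …, n`, so its coefficients vanish. -/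
theorem Submodule.sum_filter_mem_of_forall_natCast_pow_smul_mem {K V ι : Type*} [Field K]
    [AddCommGroup V] [Module K V] (W : Submodule K V) {n : ℕ}
    (hn : ∀ k : ℕ, 0 < k → k ≤ n → (k : K) ≠ 0) (s : Finset ι) (d : ι → ℕ)
    (hd : ∀ i ∈ s, d i ≤ n) (v : ι → V) (h : ∀ t : ℕ, ∑ i ∈ s, (t : K) ^ d i • v i ∈ W) (k : ℕ) :
    ∑ i ∈ s with d i = k, v i ∈ W := by
  rw [← Submodule.Quotient.mk_eq_zero, ← Submodule.mkQ_apply,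
    ← Module.forall_dual_apply_eq_zero_iff K]
  intro φ
  let p : Polynomial K := ∑ i ∈ s, Polynomial.monomial (d i) (φ (W.mkQ (v i)))
  have hp : p = 0 := by
    have hinj : Function.Injective (fun i : Fin (n + 1) => ((i : ℕ) : K)) := by
      intro i j hij
      by_contra hne
      wlog hlt : i < j generalizing i j
      · exact this hij.symm (Ne.symm hne) (lt_of_le_of_ne (not_lt.mp hlt) (Ne.symm hne))
      refine hn (j - i : ℕ) (by have := hlt; omega) (by omega) ?_
      rw [Nat.cast_sub (le_of_lt hlt)]
      exact sub_eq_zero.mpr hij.symm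
    refine Polynomial.eq_zero_of_natDegree_lt_card_of_eval_eq_zero p hinj (fun t => ?_) ?_
    · have := h t
      rw [← Submodule.Quotient.mk_eq_zero, ← Submodule.mkQ_apply] at this
      have h2 := congrArg φ this
      simp only [map_sum, map_smul, map_zero, smul_eq_mul] at h2
      simp only [p, Polynomial.eval_finsetSum, Polynomial.eval_monomial]
      rw [← h2]
      exact Finset.sum_congr rfl fun i _ => mul_comm _ _
    · rw [Fintype.card_fin, Nat.lt_succ_iff]
      exact Polynomial.natDegree_sum_le_of_forall_le _ _
        fun i hi => (Polynomial.natDegree_monomial_le _).trans (hd i hi)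
  have hc := congrArg (fun q => q.coeff k) hp
  simp only [p, Polynomial.finsetSum_coeff, Polynomial.coeff_monomial, Polynomial.coeff_zero] at hc
  rw [map_sum, map_sum, Finset.sum_filter]
  exact hc

/-! ### Lowering operators, irreducibility and derivations -/

/-- The lowering data of a representation with a basis `b 0, …, b n`: a unipotent family
`u t` acting as the polynomial `∑ i, t ^ i • D i` in `t`, whose linear term sends `b i` to
`i • b (i - 1)`, and an element `w` sending `b 0` to `b n`. -/
structure LoweringData {K G V : Type*} [Field K] [Group G] [AddCommGroup V] [Module K V]
    (ρ : Representation K G V) (n : ℕ) where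
  b : Module.Basis (Fin (n + 1)) K V
  D : ℕ → V →ₗ[K] V
  u : ℕ → G
  w : G
  D_zero : D 0 = LinearMap.id
  -- At `i = 0` the coefficient is zero, so the truncated index is harmless.
  D_one : ∀ i : Fin (n + 1), D 1 (b i) = ((i : ℕ) : K) • b ⟨i - 1, by omega⟩
  apply_u : ∀ t x, ρ (u t) x = ∑ i ∈ Finset.range (n + 1), (t : K) ^ i • D i x
  apply_w : ρ w (b 0) = b (Fin.last n)

namespace LoweringData

variable {K G V : Type*} [Field K] [Group G] [AddCommGroup V] [Module K V]
  {ρ : Representation K G V} {n : ℕ} (d : LoweringData ρ n)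

include d

/-- Lowering data of the extension of scalars. -/
noncomputable def baseChange (L : Type*) [Field L] [Algebra K L] :
    LoweringData (repBaseChange L ρ) n where
  b := d.b.baseChange L
  D i := (d.D i).baseChange L
  u := d.u
  w := d.w
  D_zero := by rw [d.D_zero]; exact LinearMap.baseChange_id
  D_one i := by
    simp only [Module.Basis.baseChange_apply, LinearMap.baseChange_tmul, d.D_one,
      TensorProduct.tmul_smul]
    rw [← algebraMap_smul L, map_natCast]
  apply_u t x := by
    have h : ρ (d.u t) = ∑ i ∈ Finset.range (n + 1), (t : K) ^ i • d.D i := by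
      ext x
      simp [d.apply_u]
    change (ρ (d.u t)).baseChange L x = _
    induction x with
    | zero => simp
    | add x y hx hy => simp only [map_add, hx, hy, smul_add, Finset.sum_add_distrib]
    | tmul a x =>
      simp only [LinearMap.baseChange_tmul, d.apply_u, TensorProduct.tmul_sum,
        TensorProduct.tmul_smul]
      refine Finset.sum_congr rfl fun i _ => ?_
      rw [← algebraMap_smul L, map_pow, map_natCast]
  apply_w := by
    change (ρ d.w).baseChange L _ = _
    simp [d.apply_w]

theorem D_one_mem (hn : ∀ k : ℕ, 0 < k → k ≤ n → (k : K) ≠ 0) {W : Submodule K V}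
    (hW : ∀ g, ∀ x ∈ W, ρ g x ∈ W) (x : V) (hx : x ∈ W) : d.D 1 x ∈ W := by
  have h := W.sum_filter_mem_of_forall_natCast_pow_smul_mem hn (Finset.range (n + 1)) id
    (fun i hi => Nat.lt_succ_iff.mp (Finset.mem_range.mp hi)) (fun i => d.D i x)
    (fun t => by simpa only [d.apply_u, id] using hW (d.u t) x hx) 1
  -- For `n = 0` the expansion has no linear term, but then `D 1` itself is zero.
  rcases Nat.eq_zero_or_pos n with rfl | hpos
  · have : d.D 1 = 0 := d.b.ext fun i => by
      rw [d.D_one]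
      simp
    simp [this]
  · rwa [show (Finset.range (n + 1)).filter (fun i => id i = 1) = {1} by
      ext i; simp only [Finset.mem_filter, Finset.mem_range, id, Finset.mem_singleton]; omega,
      Finset.sum_singleton] at h

theorem D_one_pow (j : ℕ) (i : Fin (n + 1)) :
    (d.D 1 ^ j) (d.b i) = ((i : ℕ).descFactorial j : K) • d.b ⟨i - j, by omega⟩ := by
  induction j with
  | zero => simp
  | succ j ih =>
    rw [pow_succ', Module.End.mul_apply, ih, map_smul, d.D_one, smul_smul,
      Nat.descFactorial_succ, mul_comm ((i : ℕ) - j), Nat.cast_mul]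
    rfl

theorem b_zero_mem (hn : ∀ k : ℕ, 0 < k → k ≤ n → (k : K) ≠ 0) {W : Submodule K V}
    (hW : ∀ x ∈ W, d.D 1 x ∈ W) (h0 : W ≠ ⊥) : d.b 0 ∈ W := by
  obtain ⟨x, hx, hx0⟩ := W.ne_bot_iff.mp h0
  have hs : (d.b.repr x).support.Nonempty := by
    rwa [Finsupp.support_nonempty_iff, ne_eq, LinearEquiv.map_eq_zero_iff]
  -- For the largest index `j` occurring in `x`, the power `D 1 ^ j` kills all other terms and sends
  -- `b j` to `j! • b 0`, where `j!` is invertible.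
  obtain ⟨j, hj, hmax⟩ := (d.b.repr x).support.exists_max_image id hs
  have hpow : ∀ k : ℕ, (d.D 1 ^ k) x ∈ W := by
    intro k
    induction k with
    | zero => simpa using hx
    | succ k ih => rw [pow_succ', Module.End.mul_apply]; exact hW _ ih
  have hc := hpow j
  rw [← d.b.sum_repr x, map_sum, Finset.sum_eq_single j] at hc
  · rw [map_smul, d.D_one_pow, Nat.descFactorial_self, smul_smul] at hc
    have hne : (d.b.repr x j * ((j : ℕ).factorial : K)) ≠ 0 := by
      refine mul_ne_zero (Finsupp.mem_support_iff.mp hj) ?_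
      have : ∀ k ≤ n, (k.factorial : K) ≠ 0 := by
        intro k
        induction k with
        | zero => simp
        | succ k ih =>
          intro hk
          rw [Nat.factorial_succ, Nat.cast_mul]
          exact mul_ne_zero (hn _ k.succ_pos hk) (ih (by omega))
      exact this _ (Nat.lt_succ_iff.mp j.2)
    have := (W.smul_mem_iff hne).mp hc
    convert this
    simp
  · intro i _ hij
    rw [map_smul, d.D_one_pow]
    by_cases hi : i ∈ (d.b.repr x).support
    · have hlt : i < j := lt_of_le_of_ne (hmax i hi) hij
      rw [Nat.descFactorial_of_lt hlt]
      simp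
    · rw [Finsupp.notMem_support_iff.mp hi, zero_smul]
  · simp

theorem eq_top_of_b_last_mem (hn : ∀ k : ℕ, 0 < k → k ≤ n → (k : K) ≠ 0) {W : Submodule K V}
    (hW : ∀ x ∈ W, d.D 1 x ∈ W) (hl : d.b (Fin.last n) ∈ W) : W = ⊤ := by
  have key : ∀ j : ℕ, ∀ hj : j ≤ n, d.b ⟨n - j, by omega⟩ ∈ W := by
    intro j
    induction j with
    | zero => exact fun _ => hl
    | succ j ih =>
      intro hj
      have h := hW _ (ih (by omega))
      rw [d.D_one, W.smul_mem_iff (hn _ (by simp; omega) (by simp))] at h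
      exact h
  rw [eq_top_iff, ← d.b.span_eq, Submodule.span_le]
  rintro _ ⟨i, rfl⟩
  have := key (n - i) (by omega)
  have hi : (⟨n - (n - i), by omega⟩ : Fin (n + 1)) = i := Fin.ext (by simp only; omega)
  rwa [hi] at this

/-- The hypothesis asks only for stability under the conjugates of `D 1`, not under the group. This
is what an ideal stable under derivations provides. -/
theorem eq_top (hn : ∀ k : ℕ, 0 < k → k ≤ n → (k : K) ≠ 0) {W : Submodule K V}
    (hW : ∀ g, ∀ x, ρ g x ∈ W → ρ g (d.D 1 x) ∈ W) (h0 : W ≠ ⊥) : W = ⊤ := by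
  refine d.eq_top_of_b_last_mem hn (fun x hx => ?_) ?_
  · have := hW 1 x
    simp only [map_one, Module.End.one_apply] at this
    exact this hx
  · rw [← d.apply_w]
    refine d.b_zero_mem (W := W.comap (ρ d.w)) hn (fun x hx => hW d.w x hx) fun h => h0 ?_
    rw [eq_bot_iff]
    intro x hx
    have : ρ d.w⁻¹ x ∈ W.comap (ρ d.w) := by
      rw [Submodule.mem_comap, ρ.self_inv_apply]
      exact hx
    rw [h, Submodule.mem_bot] at this
    rw [Submodule.mem_bot, ← ρ.self_inv_apply d.w x, this, map_zero]

theorem eq_top_of_invariant (hn : ∀ k : ℕ, 0 < k → k ≤ n → (k : K) ≠ 0) {W : Submodule K V}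
    (hW : ∀ g, ∀ x ∈ W, ρ g x ∈ W) (h0 : W ≠ ⊥) : W = ⊤ := by
  refine d.eq_top hn (fun g x hx => hW g _ (d.D_one_mem hn hW x ?_)) h0
  simpa using hW g⁻¹ _ hx

theorem nontrivial : Nontrivial V := ⟨d.b 0, 0, d.b.ne_zero 0⟩

theorem isIrreducible (hn : ∀ k : ℕ, 0 < k → k ≤ n → (k : K) ≠ 0) : ρ.IsIrreducible where
  exists_pair_ne := by
    have := d.nontrivial
    exact ⟨⊥, ⊤, fun h => bot_ne_top (congrArg Subrepresentation.toSubmodule h)⟩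
  eq_bot_or_eq_top W := by
    by_cases h : W.toSubmodule = ⊥
    · exact Or.inl (Subrepresentation.toSubmodule_injective h)
    · exact Or.inr (Subrepresentation.toSubmodule_injective
        (d.eq_top_of_invariant hn (fun g x hx => W.apply_mem_toSubmodule g hx) h))

/-- Compare the coefficients of `t` in `u t (B x y) = B (u t x) (u t y)`. The right side has degree
up to `2 * n`, whence the stronger bound on the characteristic. -/
theorem D_one_leibniz (hn : ∀ k : ℕ, 0 < k → k ≤ 2 * n → (k : K) ≠ 0) (hpos : 0 < n)
    {B : V →ₗ[K] V →ₗ[K] V} (hB : ∀ g x y, ρ g (B x y) = B (ρ g x) (ρ g y)) (x y : V) :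
    d.D 1 (B x y) = B (d.D 1 x) y + B x (d.D 1 y) := by
  let R := Finset.range (n + 1)
  have h := (⊥ : Submodule K V).sum_filter_mem_of_forall_natCast_pow_smul_mem hn
    ((R ×ˢ R).disjSum R) (Sum.elim (fun p => p.1 + p.2) id)
    (by
      rintro (⟨i, j⟩ | i) hi <;> simp [R] at hi ⊢ <;> omega)
    (Sum.elim (fun p => B (d.D p.1 x) (d.D p.2 y)) (fun i => - d.D i (B x y)))
    (fun t => by
      have := hB (d.u t) x y
      simp only [d.apply_u, map_sum, LinearMap.sum_apply, map_smul, LinearMap.smul_apply] at this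
      rw [Submodule.mem_bot, Finset.sum_disjSum]
      simp only [Sum.elim_inl, Sum.elim_inr, smul_neg, Finset.sum_neg_distrib, id]
      rw [add_neg_eq_zero, this, Finset.sum_product]
      simp only [Finset.smul_sum, smul_smul, pow_add]
      rw [Finset.sum_comm]
      simp only [mul_comm]
      rfl) 1
  have hf : ((R ×ˢ R).disjSum R).filter (fun i => Sum.elim (fun p => p.1 + p.2) id i = 1) =
      {Sum.inl (1, 0), Sum.inl (0, 1), Sum.inr 1} := by
    ext a
    rcases a with ⟨i, j⟩ | i <;> simp [R] <;> omega
  rw [hf, Finset.sum_insert (by simp), Finset.sum_insert (by simp), Finset.sum_singleton] at h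
  simp only [Sum.elim_inl, Sum.elim_inr, d.D_zero, LinearMap.id_apply, Submodule.mem_bot] at h
  rw [← add_assoc, add_neg_eq_zero] at h
  exact h.symm

end LoweringData

/-! ### Simplicity of equivariant algebras -/

namespace LoweringData

variable {K G V : Type*} [Field K] [Group G] [AddCommGroup V] [Module K V]
  {ρ : Representation K G V} {n : ℕ} (d : LoweringData ρ n)

include d

/-- An algebra with nonzero product on which `G` acts by automorphisms, through a representation
with lowering data, is simple. -/
theorem isSimpleAlg (hn : ∀ k : ℕ, 0 < k → k ≤ 2 * n → (k : K) ≠ 0) (hpos : 0 < n)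
    {B : V →ₗ[K] V →ₗ[K] V} (hB : ∀ g x y, ρ g (B x y) = B (ρ g x) (ρ g y)) (hB0 : B ≠ 0) :
    IsSimpleAlg B := by
  have hn' : ∀ k : ℕ, 0 < k → k ≤ n → (k : K) ≠ 0 := fun k hk hkn => hn k hk (by omega)
  have hfin : Module.Finite K V := Module.Finite.of_basis d.b
  refine ⟨d.nontrivial, fun I hI => or_iff_not_imp_left.mpr fun hI0 => ?_⟩
  obtain ⟨J, ⟨hJ, hJ0, hJI⟩, hmin⟩ := wellFounded_lt.has_min
    {J : Submodule K V | IsAlgIdeal B J ∧ J ≠ ⊥ ∧ J ≤ I} ⟨I, hI, hI0, le_rfl⟩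
  replace hmin : ∀ J', IsAlgIdeal B J' → J' ≤ J → J' ≠ ⊥ → J ≤ J' := fun J' h1 h2 h3 => by
    by_contra hlt
    exact hmin J' ⟨h1, h3, h2.trans hJI⟩ (lt_of_le_not_ge h2 hlt)
  suffices J = ⊤ from top_le_iff.mp (this ▸ hJI)
  by_cases hJJ : ∀ x ∈ J, ∀ y ∈ J, B x y = 0
  · exfalso
    have hmap : ∀ k, IsAlgIdeal B (J.map (ρ k)) := by
      rintro k _ ⟨x, hx, rfl⟩ y
      obtain ⟨h1, h2⟩ := hJ x hx (ρ k⁻¹ y)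
      exact ⟨⟨_, h1, by rw [hB, ρ.self_inv_apply]⟩, ⟨_, h2, by rw [hB, ρ.self_inv_apply]⟩⟩
    -- The product lies in the ideal `J ⊓ k J`. If this is nonzero, minimality gives `J ≤ k J`, and
    -- the product is the `k`-translate of one inside `J`.
    have h1 : ∀ k, ∀ x ∈ J, ∀ y ∈ J, B x (ρ k y) = 0 := by
      intro k x hx y hy
      have hz : B x (ρ k y) ∈ J ⊓ J.map (ρ k) :=
        ⟨(hJ x hx _).1, (hmap k _ (Submodule.mem_map_of_mem hy) _).2⟩
      by_cases hbot : J ⊓ J.map (ρ k) = ⊥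
      · rwa [hbot] at hz
      · have hinf : IsAlgIdeal B (J ⊓ J.map (ρ k)) := fun a ha b =>
          ⟨⟨(hJ a ha.1 b).1, (hmap k a ha.2 b).1⟩, ⟨(hJ a ha.1 b).2, (hmap k a ha.2 b).2⟩⟩
        obtain ⟨x', hx', rfl⟩ := (hmin _ hinf inf_le_left hbot hx).2
        rw [← hB, hJJ x' hx' y hy, map_zero]
    have h2 : ∀ g h, ∀ x ∈ J, ∀ y ∈ J, B (ρ g x) (ρ h y) = 0 := by
      intro g h x hx y hy
      have := congrArg (ρ g) (h1 (g⁻¹ * h) x hx y hy)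
      rwa [hB, map_mul, Module.End.mul_apply, ρ.self_inv_apply, map_zero] at this
    -- The union of the translates of `J` has an invariant nonzero span, hence spans `V`.
    let S : Set V := {z | ∃ g, ∃ x ∈ J, ρ g x = z}
    have hS : Submodule.span K S = ⊤ := by
      refine d.eq_top_of_invariant hn' (fun g x hx => ?_) fun hbot => hJ0 ?_
      · induction hx using Submodule.span_induction with
        | mem x hx =>
          obtain ⟨h, y, hy, rfl⟩ := hx
          exact Submodule.subset_span ⟨g * h, y, hy, by rw [map_mul]; rfl⟩
        | zero => simp
        | add x y _ _ hx hy => rw [map_add]; exact add_mem hx hy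
        | smul a x _ hx => rw [map_smul]; exact Submodule.smul_mem _ _ hx
      · rw [eq_bot_iff, ← hbot]
        exact fun x hx => Submodule.subset_span ⟨1, x, hx, by simp⟩
    refine hB0 (LinearMap.ext_on hS ?_)
    rintro _ ⟨g, x, hx, rfl⟩
    refine LinearMap.ext_on hS ?_
    rintro _ ⟨h, y, hy, rfl⟩
    exact h2 g h x hx y hy
  · push Not at hJJ
    obtain ⟨x₀, hx₀, y₀, hy₀, hne⟩ := hJJ
    refine d.eq_top hn' (fun g x hx => ?_) hJ0
    let E : V →ₗ[K] V := ρ g ∘ₗ d.D 1 ∘ₗ ρ g⁻¹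
    have hE : ∀ x y, E (B x y) = B (E x) y + B x (E y) := by
      intro x y
      simp only [E, LinearMap.comp_apply, hB, d.D_one_leibniz hn hpos hB, map_add,
        ρ.self_inv_apply]
    -- By the Leibniz rule the right side is an ideal, and it contains `J J`, since `E` maps a
    -- product of two elements of `J` into `J`. Minimality applies because `J J ≠ 0`.
    have hJE : J ≤ J ⊓ J.comap E := by
      refine hmin _ (fun a ha b => ?_) inf_le_left ?_
      · refine ⟨⟨(hJ a ha.1 b).1, ?_⟩, ⟨(hJ a ha.1 b).2, ?_⟩⟩
        · rw [SetLike.mem_coe, Submodule.mem_comap, hE]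
          exact add_mem (hJ _ ha.2 _).1 (hJ _ ha.1 _).1
        · rw [SetLike.mem_coe, Submodule.mem_comap, hE]
          exact add_mem (hJ _ ha.1 _).2 (hJ _ ha.2 _).2
      · refine Submodule.ne_bot_iff _ |>.mpr ⟨B x₀ y₀, ⟨(hJ x₀ hx₀ _).1, ?_⟩, hne⟩
        rw [SetLike.mem_coe, Submodule.mem_comap, hE]
        exact add_mem (hJ _ hy₀ _).2 (hJ _ hx₀ _).1
    have : E (ρ g x) ∈ J := (hJE hx).2
    rwa [LinearMap.comp_apply, LinearMap.comp_apply,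
      ρ.inv_self_apply] at this

end LoweringData

/-! ### Cayley's omega process and transvectants -/

section Transvectant

variable {F : Type u} [Field F]

/-- The chain rule for a linear substitution. -/
theorem pderiv_formSubst (A : Matrix (Fin 2) (Fin 2) F) (j : Fin 2)
    (f : MvPolynomial (Fin 2) F) :
    pderiv j (formSubst F A f) = A 0 j • formSubst F A (pderiv 0 f) +
      A 1 j • formSubst F A (pderiv 1 f) := by
  induction f using MvPolynomial.induction_on with
  | C a => simp [formSubst]
  | add p q hp hq => simp only [map_add, hp, hq, smul_add]; abel
  | mul_X p i hp =>
    have hX : pderiv j (formSubst F A (X i)) = C (A i j) := by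
      fin_cases j <;> simp [formSubst, pderiv_X, Derivation.leibniz]
    simp only [map_mul, Derivation.leibniz, hp, hX, map_add, smul_eq_mul]
    fin_cases i <;>
      simp [pderiv_X, smul_eq_C_mul] <;> ring

variable (F) in
/-- Cayley's omega operator on `F[X, Y] ⊗ F[X, Y]`. -/
noncomputable def cayleyOmega : Module.End F
    (MvPolynomial (Fin 2) F ⊗[F] MvPolynomial (Fin 2) F) :=
  TensorProduct.map (pderiv 0).toLinearMap (pderiv 1).toLinearMap -
    TensorProduct.map (pderiv 1).toLinearMap (pderiv 0).toLinearMap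

theorem cayleyOmega_tmul (f g : MvPolynomial (Fin 2) F) :
    cayleyOmega F (f ⊗ₜ g) = pderiv 0 f ⊗ₜ pderiv 1 g - pderiv 1 f ⊗ₜ pderiv 0 g := rfl

theorem cayleyOmega_map_formSubst (A : Matrix (Fin 2) (Fin 2) F)
    (z : MvPolynomial (Fin 2) F ⊗[F] MvPolynomial (Fin 2) F) :
    cayleyOmega F (TensorProduct.map (formSubst F A).toLinearMap (formSubst F A).toLinearMap z) =
      A.det • TensorProduct.map (formSubst F A).toLinearMap (formSubst F A).toLinearMap
        (cayleyOmega F z) := by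
  induction z with
  | zero => simp
  | add x y hx hy => simp only [map_add, hx, hy, smul_add]
  | tmul f g =>
    simp only [TensorProduct.map_tmul, AlgHom.toLinearMap_apply, cayleyOmega_tmul,
      pderiv_formSubst, map_sub, TensorProduct.add_tmul, TensorProduct.tmul_add,
      ← TensorProduct.smul_tmul', TensorProduct.tmul_smul, Matrix.det_fin_two]
    module

theorem cayleyOmega_comm (z : MvPolynomial (Fin 2) F ⊗[F] MvPolynomial (Fin 2) F) :
    cayleyOmega F (TensorProduct.comm F _ _ z) = -TensorProduct.comm F _ _ (cayleyOmega F z) := by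
  induction z with
  | zero => simp
  | add x y hx hy => simp only [map_add, hx, hy, neg_add]
  | tmul f g => simp [cayleyOmega_tmul]

theorem pderiv_mem_homogeneousSubmodule {σ R : Type*} [CommSemiring R] {n : ℕ} (i : σ)
    {f : MvPolynomial σ R} (hf : f ∈ homogeneousSubmodule σ R (n + 1)) :
    pderiv i f ∈ homogeneousSubmodule σ R n := by
  have := IsHomogeneous.pderiv (i := i) hf
  simpa using this

variable (F) in
/-- The transvectant of order `r`, on `F[X, Y] ⊗ F[X, Y]`. -/
noncomputable def transvectant (r : ℕ) :
    MvPolynomial (Fin 2) F ⊗[F] MvPolynomial (Fin 2) F →ₗ[F] MvPolynomial (Fin 2) F :=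
  LinearMap.mul' F _ ∘ₗ cayleyOmega F ^ r

theorem transvectant_succ (r : ℕ) (z : MvPolynomial (Fin 2) F ⊗[F] MvPolynomial (Fin 2) F) :
    transvectant F (r + 1) z = transvectant F r (cayleyOmega F z) := by
  simp [transvectant, pow_succ]

/-- Each omega operator contributes a factor `A.det = 1`, and the final multiplication commutes with
an algebra homomorphism. -/
theorem transvectant_formSubst (r : ℕ) (A : Matrix (Fin 2) (Fin 2) F) (hA : A.det = 1)
    (z : MvPolynomial (Fin 2) F ⊗[F] MvPolynomial (Fin 2) F) :
    transvectant F r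
        (TensorProduct.map (formSubst F A).toLinearMap (formSubst F A).toLinearMap z) =
      formSubst F A (transvectant F r z) := by
  induction r generalizing z with
  | zero =>
    induction z with
    | zero => simp
    | add x y hx hy => simp only [map_add, hx, hy]
    | tmul f g => simp [transvectant]
  | succ r ih => rw [transvectant_succ, cayleyOmega_map_formSubst, hA, one_smul, ih,
      transvectant_succ]

theorem transvectant_comm (r : ℕ) (z : MvPolynomial (Fin 2) F ⊗[F] MvPolynomial (Fin 2) F) :
    transvectant F r (TensorProduct.comm F _ _ z) = (-1) ^ r * transvectant F r z := by
  induction r generalizing z with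
  | zero =>
    induction z with
    | zero => simp
    | add x y hx hy => simp only [map_add, hx, hy, mul_add]
    | tmul f g => simp [transvectant, mul_comm]
  | succ r ih => rw [transvectant_succ, cayleyOmega_comm, map_neg, ih, transvectant_succ]; ring

theorem transvectant_tmul_mem {r a b : ℕ} {f g : MvPolynomial (Fin 2) F}
    (hf : f ∈ homogeneousSubmodule (Fin 2) F (a + r))
    (hg : g ∈ homogeneousSubmodule (Fin 2) F (b + r)) :
    transvectant F r (f ⊗ₜ g) ∈ homogeneousSubmodule (Fin 2) F (a + b) := by
  induction r generalizing f g with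
  | zero => simpa [transvectant] using IsHomogeneous.mul hf hg
  | succ r ih =>
    rw [transvectant_succ, cayleyOmega_tmul, map_sub]
    exact sub_mem (ih (pderiv_mem_homogeneousSubmodule 0 hf) (pderiv_mem_homogeneousSubmodule 1 hg))
      (ih (pderiv_mem_homogeneousSubmodule 1 hf) (pderiv_mem_homogeneousSubmodule 0 hg))

/-- The first factor does not involve `Y`, so only the term `∂/∂X ⊗ ∂/∂Y` of the omega operator
survives. -/
theorem transvectant_X_pow_tmul (r a b c : ℕ) :
    transvectant F r ((X 0 ^ a) ⊗ₜ (X 0 ^ b * X 1 ^ c)) =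
      ((a.descFactorial r * c.descFactorial r : ℕ) : MvPolynomial (Fin 2) F) *
        (X 0 ^ (a - r) * (X 0 ^ b * X 1 ^ (c - r))) := by
  induction r generalizing a c with
  | zero => simp [transvectant]
  | succ r ih =>
    have h : cayleyOmega F ((X 0 ^ a) ⊗ₜ (X 0 ^ b * X 1 ^ c)) =
        ((a * c : ℕ) : F) • ((X 0 ^ (a - 1)) ⊗ₜ (X 0 ^ b * X 1 ^ (c - 1))) := by
      have h1 : pderiv 1 ((X 0 : MvPolynomial (Fin 2) F) ^ a) = 0 := by simp [pderiv_X]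
      have h0 : pderiv 0 ((X 0 : MvPolynomial (Fin 2) F) ^ a) = (a : F) • X 0 ^ (a - 1) := by
        simp [smul_eq_C_mul]
      have h2 : pderiv 1 ((X 0 : MvPolynomial (Fin 2) F) ^ b * X 1 ^ c) =
          (c : F) • (X 0 ^ b * X 1 ^ (c - 1)) := by
        simp [smul_eq_C_mul, Derivation.leibniz, pderiv_X]; ring
      rw [cayleyOmega_tmul, h1, h0, h2, TensorProduct.zero_tmul, sub_zero,
        ← TensorProduct.smul_tmul', TensorProduct.tmul_smul, smul_smul, Nat.cast_mul]
    rw [transvectant_succ, h, map_smul, ih, smul_eq_C_mul, map_natCast, ← mul_assoc,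
      ← Nat.cast_mul]
    rcases a with _ | a
    · simp
    rcases c with _ | c
    · simp
    rw [Nat.succ_descFactorial_succ, Nat.succ_descFactorial_succ]
    simp only [Nat.succ_sub_succ, Nat.sub_zero]
    congr 2
    ring

end Transvectant

/-! ### Equivariant alternating products and maps from the exterior square -/

section Wedge

variable {K G V N : Type*} [Field K] [Group G] [AddCommGroup V] [Module K V]
  [AddCommGroup N] [Module K N]

/-- An alternating bilinear map as an alternating map of two variables. -/
def LinearMap.IsAlt.toAlternatingMap {B : V →ₗ[K] V →ₗ[K] N} (hB : B.IsAlt) :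
    V [⋀^Fin 2]→ₗ[K] N where
  toFun v := B (v 0) (v 1)
  map_update_add' v i x y := by fin_cases i <;> simp
  map_update_smul' v i c x := by fin_cases i <;> simp
  map_eq_zero_of_eq' v i j hij hne := by
    have h : v 0 = v 1 := by
      fin_cases i <;> fin_cases j <;> first | exact absurd rfl hne | exact hij | exact hij.symm
    rw [h]
    exact hB _

variable {ρ : Representation K G V}

theorem wedgeProduct_apply (ψ : ⋀[K]^2 V →ₗ[K] V) (x y : V) :
    wedgeProduct ψ x y = ψ (exteriorPower.ιMulti K 2 ![x, y]) := rfl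

theorem wedgeProduct_isAlt (ψ : ⋀[K]^2 V →ₗ[K] V) : (wedgeProduct ψ).IsAlt := by
  intro x
  rw [wedgeProduct_apply, (exteriorPower.ιMulti K 2).map_eq_zero_of_eq ![x, x] (i := 0) (j := 1)
    rfl (by decide), map_zero]

theorem extSquare_ιMulti (g : G) (x y : V) :
    extSquare ρ g (exteriorPower.ιMulti K 2 ![x, y]) =
      exteriorPower.ιMulti K 2 ![ρ g x, ρ g y] := by
  refine (exteriorPower.map_apply_ιMulti (ρ g) ![x, y]).trans (congrArg _ ?_)
  ext i
  fin_cases i <;> rfl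

theorem eq_zero_of_wedgeProduct_eq_zero {ψ : ⋀[K]^2 V →ₗ[K] V} (h : wedgeProduct ψ = 0) :
    ψ = 0 := by
  refine exteriorPower.linearMap_ext (AlternatingMap.ext fun v => ?_)
  have := LinearMap.congr_fun₂ h (v 0) (v 1)
  rw [wedgeProduct_apply] at this
  have hv : ![v 0, v 1] = v := by ext i; fin_cases i <;> rfl
  rwa [hv] at this

theorem apply_wedgeProduct (ψ : (extSquare ρ).IntertwiningMap ρ) (g : G) (x y : V) :
    ρ g (wedgeProduct ψ.toLinearMap x y) = wedgeProduct ψ.toLinearMap (ρ g x) (ρ g y) := by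
  rw [wedgeProduct_apply, wedgeProduct_apply, ← extSquare_ιMulti]
  exact (ψ.isIntertwining _ _ g _).symm

/-- The intertwining map `⋀² V → V` given by an equivariant alternating product. -/
noncomputable def LinearMap.IsAlt.toIntertwiningMap {B : V →ₗ[K] V →ₗ[K] V} (hB : B.IsAlt)
    (hρ : ∀ g x y, ρ g (B x y) = B (ρ g x) (ρ g y)) : (extSquare ρ).IntertwiningMap ρ where
  toLinearMap := exteriorPower.alternatingMapLinearEquiv hB.toAlternatingMap
  isIntertwining' g := by
    refine exteriorPower.linearMap_ext (AlternatingMap.ext fun v => ?_)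
    have hv : ![v 0, v 1] = v := by ext i; fin_cases i <;> rfl
    rw [← hv]
    simp only [LinearMap.compAlternatingMap_apply, LinearMap.comp_apply, extSquare_ιMulti,
      exteriorPower.alternatingMapLinearEquiv_apply_ιMulti]
    exact (hρ g _ _).symm

theorem LinearMap.IsAlt.toIntertwiningMap_ιMulti {B : V →ₗ[K] V →ₗ[K] V} (hB : B.IsAlt)
    (hρ : ∀ g x y, ρ g (B x y) = B (ρ g x) (ρ g y)) (x y : V) :
    hB.toIntertwiningMap hρ (exteriorPower.ιMulti K 2 ![x, y]) = B x y :=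
  exteriorPower.alternatingMapLinearEquiv_apply_ιMulti _ _

theorem isESQ_of_surjective (ψ : (extSquare ρ).IntertwiningMap ρ) (h : Function.Surjective ψ) :
    IsESQ ρ := by
  refine ⟨LinearMap.ker ψ.toLinearMap, fun g => ψ.ker.apply_mem_toSubmodule g, ⟨?_⟩⟩
  refine Representation.Equiv.mk (ψ.toLinearMap.quotKerEquivOfSurjective h) fun g => ?_
  refine Submodule.linearMap_qext _ (LinearMap.ext fun x => ?_)
  exact ψ.isIntertwining _ _ g x

theorem isESQ_of_isIrreducible [ρ.IsIrreducible] {B : V →ₗ[K] V →ₗ[K] V} (hB : B.IsAlt)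
    (hρ : ∀ g x y, ρ g (B x y) = B (ρ g x) (ρ g y)) (h0 : B ≠ 0) : IsESQ ρ := by
  refine isESQ_of_surjective _
    ((Representation.IsIrreducible.surjective_or_eq_zero (hB.toIntertwiningMap hρ)).resolve_right
      fun h => h0 ?_)
  ext x y
  rw [← hB.toIntertwiningMap_ιMulti hρ, h]
  rfl

/-- A representation acting by automorphisms of an algebra, as a homomorphism to the automorphism
group. -/
noncomputable def toAlgAut (ρ : Representation K G V) {B : V →ₗ[K] V →ₗ[K] V}
    (hρ : ∀ g x y, ρ g (B x y) = B (ρ g x) (ρ g y)) : G →* algAut B :=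
  ((LinearMap.GeneralLinearGroup.generalLinearEquiv K V).toMonoidHom.comp
    (MonoidHom.toHomUnits ρ)).codRestrict (algAut B) hρ

theorem toAlgAut_apply (ρ : Representation K G V) {B : V →ₗ[K] V →ₗ[K] V}
    (hρ : ∀ g x y, ρ g (B x y) = B (ρ g x) (ρ g y)) (g : G) (x : V) :
    (toAlgAut ρ hρ g : V ≃ₗ[K] V) x = ρ g x := rfl

/-- The automorphism group contains the image of `G`, which already acts irreducibly. -/
theorem LoweringData.algAutRep_isIrreducible {n : ℕ} (d : LoweringData ρ n)
    (hn : ∀ k : ℕ, 0 < k → k ≤ n → (k : K) ≠ 0) {B : V →ₗ[K] V →ₗ[K] V}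
    (hρ : ∀ g x y, ρ g (B x y) = B (ρ g x) (ρ g y)) : (algAutRep B).IsIrreducible where
  exists_pair_ne := by
    have := d.nontrivial
    exact ⟨⊥, ⊤, fun h => bot_ne_top (congrArg Subrepresentation.toSubmodule h)⟩
  eq_bot_or_eq_top W := by
    by_cases h : W.toSubmodule = ⊥
    · exact Or.inl (Subrepresentation.toSubmodule_injective h)
    · exact Or.inr (Subrepresentation.toSubmodule_injective
        (d.eq_top_of_invariant hn
          (fun g x hx => W.apply_mem_toSubmodule (toAlgAut ρ hρ g) hx) h))

end Wedge

/-! ### Binary forms: monomial basis, kernel of the action, transvectant product -/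

section BinaryForms

variable (F : Type u) [Field F]

theorem X_pow_mul_X_pow_mem_homogeneousSubmodule {m i j : ℕ} (h : i + j = m) :
    (X 0 ^ i * X 1 ^ j : MvPolynomial (Fin 2) F) ∈ homogeneousSubmodule (Fin 2) F m :=
  h ▸ (isHomogeneous_X_pow 0 i).mul (isHomogeneous_X_pow 1 j)

/-- The monomial `X ^ (m - j) * Y ^ j` as a form of degree `m`. -/
noncomputable def formMonomial (m : ℕ) (j : Fin (m + 1)) : homogeneousSubmodule (Fin 2) F m :=
  ⟨X 0 ^ (m - j : ℕ) * X 1 ^ (j : ℕ), X_pow_mul_X_pow_mem_homogeneousSubmodule F (by omega)⟩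

/-- The monomial basis of the space of binary forms of degree `m`. -/
noncomputable def formBasis (m : ℕ) :
    Module.Basis (Fin (m + 1)) F (homogeneousSubmodule (Fin 2) F m) :=
  Module.Basis.mk (v := formMonomial F m)
    (by
      refine LinearIndependent.of_comp (Submodule.subtype _) ?_
      let e : Fin (m + 1) → (Fin 2 →₀ ℕ) :=
        fun j => Finsupp.equivFunOnFinite.symm ![m - j, j]
      have he : Function.Injective e := fun i j hij => by
        have := DFunLike.congr_fun hij 1
        exact Fin.ext this
      have h := (basisMonomials (Fin 2) F).linearIndependent.comp e he
      have hf : Submodule.subtype _ ∘ formMonomial F m = basisMonomials (Fin 2) F ∘ e := by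
        ext1 j
        simp [e, monomial_fin_two, formMonomial]
      rwa [hf])
    (by
      rintro ⟨f, hf⟩ -
      rw [← Submodule.comap_map_eq_of_injective (Submodule.subtype_injective _)
        (Submodule.span F _), Submodule.map_span, Submodule.mem_comap, Submodule.subtype_apply]
      rw [homogeneousSubmodule_eq_finsupp_supported, AddMonoidAlgebra.supported_eq_span_single]
        at hf
      refine Submodule.span_mono ?_ hf
      rintro _ ⟨d, hd, rfl⟩
      have hd' : d 0 + d 1 = m := by
        rw [← Set.mem_ofPred.mp hd, Finsupp.degree_eq_sum, Fin.sum_univ_two]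
      refine ⟨_, ⟨⟨d 1, by omega⟩, rfl⟩, ?_⟩
      change _ = monomial d 1
      rw [monomial_fin_two, Submodule.subtype_apply, C_1, one_mul]
      simp only [formMonomial]
      congr 2
      omega)

theorem formBasis_apply (m : ℕ) (j : Fin (m + 1)) :
    (formBasis F m j : MvPolynomial (Fin 2) F) = X 0 ^ (m - j : ℕ) * X 1 ^ (j : ℕ) := by
  simp [formBasis, formMonomial]

theorem coe_binaryForms_inv (m : ℕ) (g : SL(2, F)) (f : homogeneousSubmodule (Fin 2) F m) :
    (binaryForms F m g⁻¹ f : MvPolynomial (Fin 2) F) = formSubst F g.1 f := by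
  change formSubst F (g⁻¹⁻¹ : SL(2, F)).1 f = _
  rw [inv_inv]

/-- The lower unitriangular element of `SL(2, F)` with off-diagonal entry `t`. -/
def lowerUnipotent (t : F) : SL(2, F) := ⟨!![1, 0; t, 1], by simp [Matrix.det_fin_two]⟩

theorem formSubst_lowerUnipotent_X_zero (t : F) :
    formSubst F (lowerUnipotent F t).1 (X 0) = X 0 := by
  simp [formSubst, lowerUnipotent]

theorem formSubst_lowerUnipotent_X_one (t : F) :
    formSubst F (lowerUnipotent F t).1 (X 1) = C t * X 0 + X 1 := by
  simp [formSubst, lowerUnipotent]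

/-- The Weyl element of `SL(2, F)`. -/
def weylElement : SL(2, F) := ⟨!![0, 1; -1, 0], by simp [Matrix.det_fin_two]⟩

theorem formSubst_weylElement_X_zero : formSubst F (weylElement F).1 (X 0) = X 1 := by
  simp [formSubst, weylElement]

/-- The divided power `X ^ i * (∂/∂Y) ^ i / i!` on binary forms of degree `m`. -/
noncomputable def formLowering (m i : ℕ) :
    homogeneousSubmodule (Fin 2) F m →ₗ[F] homogeneousSubmodule (Fin 2) F m :=
  (formBasis F m).constr F fun j =>
    ((j : ℕ).choose i : F) • formBasis F m ⟨j - i, by omega⟩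

theorem formLowering_formBasis (m i : ℕ) (j : Fin (m + 1)) :
    formLowering F m i (formBasis F m j) =
      ((j : ℕ).choose i : F) • formBasis F m ⟨j - i, by omega⟩ :=
  (formBasis F m).constr_basis F _ j

theorem binaryForms_lowerUnipotent_inv (m : ℕ) (t : F) :
    binaryForms F m (lowerUnipotent F t)⁻¹ =
      ∑ i ∈ Finset.range (m + 1), t ^ i • formLowering F m i := by
  refine (formBasis F m).ext fun j => Subtype.ext ?_
  rw [coe_binaryForms_inv]
  simp only [LinearMap.sum_apply, LinearMap.smul_apply, formLowering_formBasis,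
    Submodule.coe_sum, Submodule.coe_smul, formBasis_apply, map_mul, map_pow,
    formSubst_lowerUnipotent_X_zero, formSubst_lowerUnipotent_X_one]
  rw [add_pow, Finset.mul_sum]
  -- The binomial expansion of `(t X + Y) ^ j` stops at `i = j`; for larger `i` the coefficient
  -- `choose j i` is zero.
  refine Finset.sum_subset_zero_on_sdiff (Finset.range_mono (by omega)) (fun i hi => ?_)
    fun i hi => ?_
  · rw [Nat.choose_eq_zero_of_lt]
    · simp
    · simp at hi; omega
  · have hij : i ≤ j := by simp at hi; omega
    rw [show m - (j - i : ℕ) = (m - j) + i by omega]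
    simp only [smul_eq_C_mul, mul_pow, pow_add, map_pow, map_natCast]
    ring

/-- Lowering data of the representation of `SL(2, F)` on binary forms. -/
noncomputable def binaryFormsLoweringData (m : ℕ) : LoweringData (binaryForms F m) m where
  b := formBasis F m
  D := formLowering F m
  -- The left action substitutes by the inverse matrix, so inverses give the plain substitutions.
  u t := (lowerUnipotent F t)⁻¹
  w := (weylElement F)⁻¹
  D_zero := (formBasis F m).ext fun j => by simp [formLowering_formBasis]
  D_one j := by simp [formLowering_formBasis]
  apply_u t x := by simp [binaryForms_lowerUnipotent_inv]
  apply_w := by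
    refine Subtype.ext ?_
    rw [coe_binaryForms_inv, formBasis_apply, formBasis_apply]
    simp [formSubst_weylElement_X_zero]

theorem binaryForms_neg_one {m : ℕ} (hm : Even m) : binaryForms F m (-1) = 1 := by
  refine (formBasis F m).ext fun j => Subtype.ext ?_
  have h : (-1 : SL(2, F))⁻¹ = -1 := inv_eq_of_mul_eq_one_left (by simp)
  rw [← h, coe_binaryForms_inv, formBasis_apply]
  have hX : ∀ i, formSubst F (-1 : SL(2, F)).1 (X i) = -X i := by
    intro i
    fin_cases i <;> simp [formSubst]
  rw [map_mul, map_pow, map_pow, hX, hX, neg_pow, neg_pow (X 1 : MvPolynomial (Fin 2) F),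
    mul_mul_mul_comm, ← pow_add, Nat.sub_add_cancel (by omega), hm.neg_one_pow, one_mul,
    Module.End.one_apply, formBasis_apply]

theorem eq_one_or_eq_neg_one_of_binaryForms_eq_one {m : ℕ} (hm : 2 ≤ m) {g : SL(2, F)}
    (hg : binaryForms F m g = 1) : g = 1 ∨ g = -1 := by
  have hinv : binaryForms F m g⁻¹ = 1 := by
    have := (binaryForms F m).inv_self_apply g
    ext1 x
    have h := this x
    rwa [hg] at h
  -- Evaluating the fixed monomials at points of `F ^ 2` gives scalar equations for the entries of
  -- `g`.
  have key : ∀ i j : ℕ, i + j = m → ∀ x y : F,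
      (g 0 0 * x + g 0 1 * y) ^ i * (g 1 0 * x + g 1 1 * y) ^ j = x ^ i * y ^ j := by
    intro i j hij x y
    have h := coe_binaryForms_inv F m g ⟨_, X_pow_mul_X_pow_mem_homogeneousSubmodule F hij⟩
    rw [hinv] at h
    simpa [formSubst] using (congrArg (eval ![x, y]) h).symm
  have hm0 : m ≠ 0 := by omega
  have hb : g 0 1 = 0 := by simpa [hm0] using key m 0 (by omega) 0 1
  have hc : g 1 0 = 0 := by simpa [hm0] using key 0 m (by omega) 1 0
  have ha : g 0 0 ^ m = 1 := by simpa using key m 0 (by omega) 1 0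
  have had : g 0 0 * g 1 1 = 1 := by
    have := g.2
    rw [Matrix.det_fin_two] at this
    simpa [hb, hc] using this
  -- For diagonal entries `a`, `d` the monomial `X ^ (m - 1) * Y` gives `a ^ (m - 1) * d = 1`; as `a
  -- * d = 1`, this is `a ^ (m - 2) = 1`. With `a ^ m = 1` it forces `a ^ 2 = 1`.
  have ha' : g 0 0 ^ (m - 2) = 1 := by
    have := key (m - 1) 1 (by omega) 1 1
    simp only [hb, hc, mul_one, zero_add, add_zero, pow_one, one_pow] at this
    rwa [show m - 1 = (m - 2) + 1 by omega, pow_succ, mul_assoc, had, mul_one] at this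
  have hsq : g 0 0 ^ 2 = 1 := by
    rwa [show m = (m - 2) + 2 by omega, pow_add, ha', one_mul] at ha
  rcases mul_self_eq_one_iff.mp ((sq _).symm.trans hsq) with h | h
  · left
    have hd : g 1 1 = 1 := by rwa [h, one_mul] at had
    ext i j
    fin_cases i <;> fin_cases j <;> simp [h, hd, hb, hc]
  · right
    have hd : g 1 1 = -1 := by rwa [h, neg_one_mul, neg_eq_iff_eq_neg] at had
    ext i j
    fin_cases i <;> fin_cases j <;> simp [h, hd, hb, hc]

theorem binaryForms_eq_one_iff {m : ℕ} (hm : 2 ≤ m) (he : Even m) (g : SL(2, F)) :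
    binaryForms F m g = 1 ↔ g = 1 ∨ g = -1 := by
  refine ⟨eq_one_or_eq_neg_one_of_binaryForms_eq_one F hm, ?_⟩
  rintro (rfl | rfl)
  · exact map_one _
  · exact binaryForms_neg_one F he

/-- The transvectant of order `r` as a product on the space of binary forms of degree `2 * r`. -/
noncomputable def transvectantProduct (r : ℕ) :
    homogeneousSubmodule (Fin 2) F (2 * r) →ₗ[F] homogeneousSubmodule (Fin 2) F (2 * r) →ₗ[F]
      homogeneousSubmodule (Fin 2) F (2 * r) :=
  LinearMap.mk₂ F
    (fun f g => ⟨transvectant F r ((f : MvPolynomial (Fin 2) F) ⊗ₜ (g : MvPolynomial (Fin 2) F)),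
      by
        have h := transvectant_tmul_mem (r := r) (a := r) (b := r)
          (by rw [← two_mul]; exact f.2) (by rw [← two_mul]; exact g.2)
        rwa [← two_mul] at h⟩)
    (fun f f' g => by ext1; simp [TensorProduct.add_tmul])
    (fun c f g => by ext1; simp [← TensorProduct.smul_tmul'])
    (fun f g g' => by ext1; simp [TensorProduct.tmul_add])
    (fun c f g => by ext1; simp)

theorem coe_transvectantProduct (r : ℕ) (f g : homogeneousSubmodule (Fin 2) F (2 * r)) :
    (transvectantProduct F r f g : MvPolynomial (Fin 2) F) =
      transvectant F r ((f : MvPolynomial (Fin 2) F) ⊗ₜ (g : MvPolynomial (Fin 2) F)) := rfl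

/-- Swapping the arguments multiplies the transvectant by `(-1) ^ r = -1`; as `2` is invertible,
skew-symmetric implies alternating. -/
theorem transvectantProduct_isAlt {r : ℕ} (hr : Odd r) (h2 : (2 : F) ≠ 0) :
    (transvectantProduct F r).IsAlt := by
  intro f
  ext1
  rw [coe_transvectantProduct]
  have h := transvectant_comm r ((f : MvPolynomial (Fin 2) F) ⊗ₜ[F] (f : MvPolynomial (Fin 2) F))
  rw [TensorProduct.comm_tmul, hr.neg_one_pow, neg_one_mul, eq_neg_iff_add_eq_zero, ← two_smul F,
    smul_eq_zero] at h
  exact h.resolve_left h2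

theorem binaryForms_transvectantProduct (r : ℕ) (g : SL(2, F))
    (f f' : homogeneousSubmodule (Fin 2) F (2 * r)) :
    binaryForms F (2 * r) g (transvectantProduct F r f f') =
      transvectantProduct F r (binaryForms F (2 * r) g f) (binaryForms F (2 * r) g f') := by
  ext1
  rw [← inv_inv g]
  simp only [coe_binaryForms_inv, coe_transvectantProduct]
  exact (transvectant_formSubst r _ g⁻¹.2 _).symm

theorem transvectantProduct_ne_zero {r : ℕ}
    (hn : ∀ k : ℕ, 0 < k → k ≤ 2 * r → (k : F) ≠ 0) : transvectantProduct F r ≠ 0 := by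
  intro h
  -- The test pair is `X ^ (2 * r)` and `X ^ r * Y ^ r`, whose product is `(2 * r)!` times `X ^ (2 *
  -- r)`.
  have h1 := congrArg Subtype.val (LinearMap.congr_fun₂ h
    (formBasis F (2 * r) 0) (formBasis F (2 * r) ⟨r, by omega⟩))
  rw [coe_transvectantProduct, formBasis_apply, formBasis_apply] at h1
  simp only [Fin.val_zero, pow_zero, mul_one, Nat.sub_zero, transvectant_X_pow_tmul] at h1
  have hd : ∀ a k, k ≤ a → a ≤ 2 * r → (a.descFactorial k : F) ≠ 0 := by
    intro a k
    induction k with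
    | zero => simp
    | succ k ih =>
      intro hk ha
      rw [Nat.descFactorial_succ, Nat.cast_mul]
      exact mul_ne_zero (hn _ (by omega) (by omega)) (ih (by omega) ha)
  have hX : ∀ (i : Fin 2) k, (X i ^ k : MvPolynomial (Fin 2) F) ≠ 0 :=
    fun i k => pow_ne_zero _ (X_ne_zero i)
  refine mul_ne_zero ?_ (mul_ne_zero (hX _ _) (mul_ne_zero (hX _ _) (hX _ _))) h1
  rw [← map_natCast (C (σ := Fin 2) (R := F)), ne_eq, C_eq_zero, Nat.cast_mul]
  exact mul_ne_zero (hd _ _ (by omega) le_rfl) (hd _ _ le_rfl (by omega))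

end BinaryForms

/-! ### The characteristic condition and the main theorem -/

theorem natCast_ne_zero_of_lt_ringChar {R : Type*} [NonAssocSemiring R] {n : ℕ}
    (h : ringChar R = 0 ∨ n < ringChar R) (k : ℕ) (hk : 0 < k) (hkn : k ≤ n) : (k : R) ≠ 0 := by
  rw [ne_eq, ringChar.spec]
  intro hd
  rcases h with h | h
  · rw [h, zero_dvd_iff] at hd
    omega
  · exact absurd (Nat.le_of_dvd hk hd) (by omega)

theorem mainTheorem4 (F : Type u) [Field F] (m : ℕ) (hm : m ≡ 2 [MOD 4])
    (hF : ringChar F = 0 ∨ 2 * m < ringChar F) :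
    Module.finrank F (homogeneousSubmodule (Fin 2) F m) = m + 1 ∧
    IsAbsolutelyIrreducible.{u, u, u, w} (binaryForms F m) ∧
    IsESQ (binaryForms F m) ∧
    ∀ ψ : (extSquare (binaryForms F m)).IntertwiningMap (binaryForms F m),
      Function.Surjective ψ →
        IsIAC (wedgeProduct ψ.toLinearMap) ∧
        (∃ φ : SL(2, F) →* algAut (wedgeProduct ψ.toLinearMap),
          (∀ g f, (φ g : _ ≃ₗ[F] _) f = binaryForms F m g f) ∧
          (∀ g, φ g = 1 ↔ g = 1 ∨ g = -1)) ∧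
        (5 ≤ ENat.card F → IsSimpleAlg (wedgeProduct ψ.toLinearMap)) := by
  have hmod : m % 4 = 2 := hm
  have hn := natCast_ne_zero_of_lt_ringChar hF
  have hn' : ∀ k : ℕ, 0 < k → k ≤ m → (k : F) ≠ 0 := fun k hk hkm => hn k hk (by omega)
  let d := binaryFormsLoweringData F m
  have hirr := d.isIrreducible hn'
  refine ⟨?_, fun K _ _ => ?_, ?_, fun ψ hψ => ?_⟩
  · rw [Module.finrank_eq_card_basis (formBasis F m), Fintype.card_fin]
  · refine (d.baseChange K).isIrreducible fun k hk hkm => ?_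
    rw [← map_natCast (algebraMap F K), ne_eq, map_eq_zero]
    exact hn' k hk hkm
  · obtain ⟨r, rfl⟩ : ∃ r, m = 2 * r := ⟨m / 2, by omega⟩
    have h2 : (2 : F) ≠ 0 := by exact_mod_cast hn' 2 (by omega) (by omega)
    exact isESQ_of_isIrreducible
      (transvectantProduct_isAlt F (Nat.odd_iff.mpr (by omega)) h2)
      (binaryForms_transvectantProduct F r) (transvectantProduct_ne_zero F hn')
  · have hρ := apply_wedgeProduct ψ
    refine ⟨⟨wedgeProduct_isAlt _, d.algAutRep_isIrreducible hn' hρ⟩,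
      ⟨toAlgAut _ hρ, toAlgAut_apply _ hρ, fun g => ?_⟩, fun _ => ?_⟩
    · rw [← binaryForms_eq_one_iff F (m := m) (by omega) (Nat.even_iff.mpr (by omega))]
      constructor
      · intro h
        ext1 f
        rw [← toAlgAut_apply _ hρ, h]
        rfl
      · intro h
        refine Subtype.ext (LinearEquiv.ext fun f => ?_)
        rw [toAlgAut_apply, h]
        rfl
    -- The product is nonzero because `ψ` is onto a nonzero space.
    · refine d.isSimpleAlg hn (by omega) hρ fun h0 => ?_
      have := d.nontrivial
      obtain ⟨x, hx⟩ := exists_ne (0 : homogeneousSubmodule (Fin 2) F m)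
      obtain ⟨z, rfl⟩ := hψ x
      refine hx ?_
      rw [← ψ.toLinearMap_apply _ _, eq_zero_of_wedgeProduct_eq_zero h0, LinearMap.zero_apply]
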